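/- Let $G=(V,E)$ be a finite simple graph, let $c:V\to\mathbb{N}=\{0,1,2,\dots\}$ be a degree-bound function, and let $0<\varepsilon<1$. A set $F\subseteq E$ is a feasible solution of the partial degree bounded edge packing problem (PDBEP) if for every edge $uv\in F$ we have $d_F(u)\le c_u$ or $d_F(v)\le c_v$, where $d_F$ denotes the degree in $(V,F)$; the aim is to maximize $|F|$. For a set $E_H\subseteq E$ let $V_H$ be the set of endpoints of the edges of $E_H$, let $H=(V_H,E_H)$, and let $C\subseteq V$ and $f:V\to\mathbb{N}$. Let $\mathrm{LP}(H,C,f)$ be the linear program $$\text{maximize } 2\sum_{e\in E_H}y_e-(1+\varepsilon)\sum_{v\in V_H}z_v$$ subject to $\sum_{e\in E_H,\,e\ni v}y_e\le f_v+z_v$ for $v\in V_H\setminus C$, $\sum_{e\in E_H,\,e\ni v}y_e\le f_v$ for $v\in V_H\cap C$, $z_v\ge 0$ for $v\in V_H$, and $0\le y_e\le 1$ for $e\in E_H$. The procedure $\mathrm{SolveIP2}(H,C,f)$ is as follows. If $E_H=\emptyset$, return $\emptyset$. Otherwise let $(y,z)$ be an optimal extreme point of $\mathrm{LP}(H,C,f)$.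 If some $e\in E_H$ has $y_e=0$, choose such an $e$ and return the result of the recursive call with $E_H$ replaced by $E_H\setminus\{e\}$ and the same $C$, $f$. Otherwise choose an edge $e=uv\in E_H$ with $y_e\ge 1/2$, its endpoints named so that $f_v>0$ and $z_v=0$, and return $\{e\}\cup E'$, where $E'$ is the result of the recursive call with $E_H\setminus\{e\}$, $C\cup\{v\}$, and $f$ changed by replacing $f_v$ by $f_v-1$ and $f_u$ by $\max\{f_u-1,0\}$. Theorem. Run $\mathrm{SolveIP2}$ with $E_H=E$, $C=\emptyset$, $f=c$. Whatever choices are made (of the optimal extreme point, the edge, and the endpoint), the procedure never gets stuck (the optimal extreme point, the edge and the endpoint that it asks for always exist), it ends after at most $|E|$ linear programs have been solved, and it returns a feasible solution $E'$ of PDBEP such that $|F|\le \frac{3}{(1-\varepsilon)^2}\,|E'|$ for every feasible solution $F$ of PDBEP. -/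

import Mathlib

namespace PDBEP

variable {V : Type*} [Fintype V] [DecidableEq V]

/-- The degree of the vertex `v` in the graph `(V, F)`. -/
def edgeDegree (F : Finset (Sym2 V)) (v : V) : ℕ :=
  (F.filter (fun e => v ∈ e)).card

/-- `F` is a feasible solution of the partial degree bounded edge packing problem on `(G, c)`:
a set of edges of `G` such that every edge of `F` has an endpoint whose degree in `(V, F)` is
within its bound. -/
def IsFeasible (G : SimpleGraph V) (c : V → ℕ) (F : Finset (Sym2 V)) : Prop :=
  (∀ e ∈ F, e ∈ G.edgeSet) ∧
    ∀ u v : V, s(u, v) ∈ F → edgeDegree F u ≤ c u ∨ edgeDegree F v ≤ c v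

/-- The argument `(H, C, f)` of a recursive call: the edge set of `H`, the set `C` of vertices at
which the degree bound is strict, and the current degree bounds `f`. The isolated vertices of `H`
are deleted before anything is done with them, so that the vertex set is read off from the
edges. -/
structure Subproblem (V : Type*) where
  edges : Finset (Sym2 V)
  C : Finset V
  f : V → ℕ

/-- The vertices of `H` that remain when the isolated ones are deleted. -/
def Subproblem.verts (H : Subproblem V) : Finset V :=
  Finset.univ.filter (fun v => ∃ e ∈ H.edges, v ∈ e)

/-- The feasible region of the linear program of `H`. Its variables are `y e` for the edges and
`z v` for the vertices of `H`; all other coordinates are fixed to `0`. -/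
def lpRegion (H : Subproblem V) : Set ((Sym2 V → ℝ) × (V → ℝ)) :=
  {p | (∀ e ∈ H.edges, 0 ≤ p.1 e ∧ p.1 e ≤ 1) ∧
       (∀ e, e ∉ H.edges → p.1 e = 0) ∧
       (∀ v ∈ H.verts, 0 ≤ p.2 v) ∧
       (∀ v, v ∉ H.verts → p.2 v = 0) ∧
       (∀ v ∈ H.verts, v ∉ H.C →
          ∑ e ∈ H.edges.filter (fun e => v ∈ e), p.1 e ≤ (H.f v : ℝ) + p.2 v) ∧
       (∀ v ∈ H.verts, v ∈ H.C →
          ∑ e ∈ H.edges.filter (fun e => v ∈ e), p.1 e ≤ (H.f v : ℝ))}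

/-- The objective function `2 ∑ y e - (1 + ε) ∑ z v` of the linear program of `H`. -/
noncomputable def lpObjective (ε : ℝ) (H : Subproblem V) (p : (Sym2 V → ℝ) × (V → ℝ)) : ℝ :=
  2 * ∑ e ∈ H.edges, p.1 e - (1 + ε) * ∑ v ∈ H.verts, p.2 v

/-- `(y, z)` is a possible answer of the LP solver: an optimal corner (extreme point) of the
linear program of `H`. -/
def IsLPSolution (ε : ℝ) (H : Subproblem V) (y : Sym2 V → ℝ) (z : V → ℝ) : Prop :=
  (y, z) ∈ Set.extremePoints ℝ (lpRegion H) ∧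
    ∀ p ∈ lpRegion H, lpObjective ε H p ≤ lpObjective ε H (y, z)

/-- Discard the edge `e`. -/
def Subproblem.discard (H : Subproblem V) (e : Sym2 V) : Subproblem V where
  edges := H.edges.erase e
  C := H.C
  f := H.f

/-- Take the edge `e = uv` into the solution on behalf of its endpoint `v`: remove `e`, put `v`
into `C`, and lower both bounds by one, that of `u` not below zero (this is truncated
subtraction in `ℕ`). -/
def Subproblem.take (H : Subproblem V) (u v : V) : Subproblem V where
  edges := H.edges.erase s(u, v)
  C := insert v H.C
  f := Function.update (Function.update H.f v (H.f v - 1)) u (H.f u - 1)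

/-- `SolveIP2 ε k H r`: some execution of the recursive rounding procedure on `H`, limited to `k`
calls of the LP solver, ends with the outcome `r`. The choices that the procedure leaves open
(the corner returned by the solver, the edge, and the endpoint) are made arbitrarily. The outcome
is `some E'` if `E'` is returned, and `none` if the execution fails: the `k` calls are used up,
the linear program has no optimal corner, or there is no edge or no endpoint of the kind that
the rounding step asks for. -/
inductive SolveIP2 (ε : ℝ) : ℕ → Subproblem V → Option (Finset (Sym2 V)) → Prop
  | empty (k : ℕ) (H : Subproblem V) (hE : H.edges = ∅) :
      SolveIP2 ε k H (some ∅)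
  | outOfCalls (H : Subproblem V) (hE : H.edges ≠ ∅) :
      SolveIP2 ε 0 H none
  | noSolution (k : ℕ) (H : Subproblem V) (hE : H.edges ≠ ∅)
      (hno : ∀ y z, ¬ IsLPSolution ε H y z) :
      SolveIP2 ε (k + 1) H none
  | zero (k : ℕ) (H : Subproblem V) (y : Sym2 V → ℝ) (z : V → ℝ)
      (hsol : IsLPSolution ε H y z)
      (e : Sym2 V) (he : e ∈ H.edges) (hy : y e = 0)
      (r : Option (Finset (Sym2 V))) (hr : SolveIP2 ε k (H.discard e) r) :
      SolveIP2 ε (k + 1) H r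
  | noEdge (k : ℕ) (H : Subproblem V) (hE : H.edges ≠ ∅) (y : Sym2 V → ℝ) (z : V → ℝ)
      (hsol : IsLPSolution ε H y z)
      (hpos : ∀ e ∈ H.edges, y e ≠ 0)
      (hno : ∀ e ∈ H.edges, ¬ 1 / 2 ≤ y e) :
      SolveIP2 ε (k + 1) H none
  | noEndpoint (k : ℕ) (H : Subproblem V) (y : Sym2 V → ℝ) (z : V → ℝ)
      (hsol : IsLPSolution ε H y z)
      (hpos : ∀ e ∈ H.edges, y e ≠ 0)
      (u v : V) (he : s(u, v) ∈ H.edges) (hy : 1 / 2 ≤ y s(u, v))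
      (hu : ¬ (0 < H.f u ∧ z u = 0)) (hv : ¬ (0 < H.f v ∧ z v = 0)) :
      SolveIP2 ε (k + 1) H none
  | round (k : ℕ) (H : Subproblem V) (y : Sym2 V → ℝ) (z : V → ℝ)
      (hsol : IsLPSolution ε H y z)
      (hpos : ∀ e ∈ H.edges, y e ≠ 0)
      (u v : V) (he : s(u, v) ∈ H.edges) (hy : 1 / 2 ≤ y s(u, v))
      (hf : 0 < H.f v) (hz : z v = 0)
      (r : Option (Finset (Sym2 V))) (hr : SolveIP2 ε k (H.take u v) r) :
      SolveIP2 ε (k + 1) H (r.map (fun E' => insert s(u, v) E'))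

/-- The outermost call: all edges of `G`, `C = ∅`, and `f = c`. -/
def initial (G : SimpleGraph V) [DecidableRel G.Adj] (c : V → ℕ) : Subproblem V where
  edges := G.edgeFinset
  C := ∅
  f := c

end PDBEP

/-!
The linear program is compared with both sides. A feasible `F` gives a point of the initial program
with objective at least `(1 - ε) * |F|`: its excess degrees add up to at most `|F|`, since every
edge has at most one endpoint beyond its bound (`IsFeasible.exists_le_lpObjective`). On the other
hand, discarding an edge with `y e = 0` does not lower the optimum, and taking an edge with
`y e ≥ 1 / 2` lowers it by at most `3` (`IsLPSolution.le_lpObjective_take`). As the program without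
edges has value `0`, the optimum is at most `3 * |E'|`, so that `(1 - ε) * |F| ≤ 3 * |E'|`.

The procedure does not get stuck for three reasons. An optimal corner exists because the part of the
region with nonnegative objective is compact (`exists_isLPSolution`). If `y` has no zero on the
edges, a corner has an edge with `y e ≥ 1 / 2`: otherwise `0 < y e < 1 / 2` for all `e`, being a
corner requires at least `|E|` vertices with `z v = 0` and a tight degree constraint, and each of
these has degree at least `3`, which is too much for `|E|` edges
(`IsLPSolution.exists_half_le`). Finally an edge whose endpoints both have `z > 0` contradicts
optimality (`IsLPSolution.exists_endpoint`). Each call removes an edge, whence the bound on the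
number of calls.

For feasibility, `v` enters `C` when `f v > 0`, that is, before its bound has been truncated, and
from then on the strict constraint keeps the degree of `v` within the bound. `IsGoodOutput` carries
this and the bound on the optimum through the recursion.
-/

namespace PDBEP

variable {V : Type*} [DecidableEq V]

/-! ### Incidence counts -/

lemma card_filter_mem_le_two (e : Sym2 V) (s : Finset V) :
    (s.filter (fun v => v ∈ e)).card ≤ 2 := by
  induction e with
  | _ a b =>
    refine (Finset.card_le_card (t := {a, b}) fun v hv => ?_).trans Finset.card_le_two
    simpa using (Finset.mem_filter.1 hv).2

lemma sum_card_incident (s : Finset V) (F : Finset (Sym2 V)) :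
    ∑ v ∈ s, (F.filter (fun e => v ∈ e)).card = ∑ e ∈ F, (s.filter (fun v => v ∈ e)).card :=
  Finset.sum_card_bipartiteAbove_eq_sum_card_bipartiteBelow (fun (v : V) (e : Sym2 V) => v ∈ e)

lemma edgeDegree_insert {F : Finset (Sym2 V)} {e : Sym2 V} (he : e ∉ F) (v : V) :
    edgeDegree (insert e F) v = edgeDegree F v + if v ∈ e then 1 else 0 := by
  unfold edgeDegree
  rw [Finset.filter_insert]
  split_ifs
  · exact Finset.card_insert_of_notMem fun h => he (Finset.mem_filter.1 h).1
  · rfl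

lemma edgeDegree_pos {F : Finset (Sym2 V)} {e : Sym2 V} (he : e ∈ F) {v : V} (hv : v ∈ e) :
    0 < edgeDegree F v :=
  Finset.card_pos.2 ⟨e, Finset.mem_filter.2 ⟨he, hv⟩⟩

variable [Fintype V]

/-! ### The region of the linear program -/

lemma Subproblem.mem_verts {H : Subproblem V} {v : V} :
    v ∈ H.verts ↔ ∃ e ∈ H.edges, v ∈ e := by
  simp [Subproblem.verts]

lemma Subproblem.verts_mono {H H' : Subproblem V} (h : H'.edges ⊆ H.edges) :
    H'.verts ⊆ H.verts := by
  intro v hv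
  obtain ⟨e, he, hve⟩ := Subproblem.mem_verts.1 hv
  exact Subproblem.mem_verts.2 ⟨e, h he, hve⟩

/-- Values satisfying the constraints on the edges and vertices of `H` become a point of
`lpRegion H` once the remaining coordinates are set to `0`, which `lpObjective` does not see. -/
lemma exists_mem_lpRegion (ε : ℝ) (H : Subproblem V) (y : Sym2 V → ℝ) (z : V → ℝ)
    (hy : ∀ e ∈ H.edges, 0 ≤ y e ∧ y e ≤ 1) (hz : ∀ v ∈ H.verts, 0 ≤ z v)
    (hsoft : ∀ v ∈ H.verts, v ∉ H.C →
      ∑ e ∈ H.edges.filter (fun e => v ∈ e), y e ≤ (H.f v : ℝ) + z v)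
    (hstrict : ∀ v ∈ H.verts, v ∈ H.C →
      ∑ e ∈ H.edges.filter (fun e => v ∈ e), y e ≤ (H.f v : ℝ)) :
    ∃ p ∈ lpRegion H,
      lpObjective ε H p = 2 * ∑ e ∈ H.edges, y e - (1 + ε) * ∑ v ∈ H.verts, z v := by
  have hsum : ∀ v, ∑ e ∈ H.edges.filter (fun e => v ∈ e), (if e ∈ H.edges then y e else 0) =
      ∑ e ∈ H.edges.filter (fun e => v ∈ e), y e := fun v =>
    Finset.sum_congr rfl fun e he => if_pos (Finset.mem_filter.1 he).1
  refine ⟨(fun e => if e ∈ H.edges then y e else 0, fun v => if v ∈ H.verts then z v else 0),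
    ⟨fun e he => by simpa [he] using hy e he, fun e he => by simp [he],
      fun v hv => by simpa [hv] using hz v hv, fun v hv => by simp [hv],
      fun v hv hC => ?_, fun v hv hC => ?_⟩, ?_⟩
  · simpa only [hsum, if_pos hv] using hsoft v hv hC
  · simpa only [hsum] using hstrict v hv hC
  · unfold lpObjective
    congr 2
    · exact Finset.sum_congr rfl fun e he => if_pos he
    · exact Finset.sum_congr rfl fun v hv => if_pos hv

lemma sum_incident_le {H : Subproblem V} {y : Sym2 V → ℝ} {z : V → ℝ}
    (h : (y, z) ∈ lpRegion H) {v : V} (hv : v ∈ H.verts) :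
    ∑ e ∈ H.edges.filter (fun e => v ∈ e), y e ≤ (H.f v : ℝ) + z v := by
  obtain ⟨-, -, h3, -, h5, h6⟩ := h
  by_cases hC : v ∈ H.C
  · exact (h6 v hv hC).trans (le_add_of_nonneg_right (h3 v hv))
  · exact h5 v hv hC

lemma z_nonneg {H : Subproblem V} {y : Sym2 V → ℝ} {z : V → ℝ}
    (h : (y, z) ∈ lpRegion H) (v : V) : 0 ≤ z v := by
  by_cases hv : v ∈ H.verts
  · exact h.2.2.1 v hv
  · exact (h.2.2.2.1 v hv).ge

lemma IsLPSolution.mem_lpRegion {ε : ℝ} {H : Subproblem V} {y : Sym2 V → ℝ} {z : V → ℝ}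
    (h : IsLPSolution ε H y z) : (y, z) ∈ lpRegion H :=
  h.1.1

/-! ### Existence of an optimal corner -/

lemma isClosed_lpRegion (H : Subproblem V) : IsClosed (lpRegion H) := by
  have hset : lpRegion H =
      (⋂ e ∈ H.edges, {p | 0 ≤ p.1 e} ∩ {p | p.1 e ≤ 1}) ∩
      (⋂ e, ⋂ (_ : e ∉ H.edges), {p | p.1 e = 0}) ∩
      (⋂ v ∈ H.verts, {p | 0 ≤ p.2 v}) ∩
      (⋂ v, ⋂ (_ : v ∉ H.verts), {p | p.2 v = 0}) ∩
      (⋂ v ∈ H.verts, ⋂ (_ : v ∉ H.C),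
        {p | ∑ e ∈ H.edges.filter (fun e => v ∈ e), p.1 e ≤ (H.f v : ℝ) + p.2 v}) ∩
      (⋂ v ∈ H.verts, ⋂ (_ : v ∈ H.C),
        {p | ∑ e ∈ H.edges.filter (fun e => v ∈ e), p.1 e ≤ (H.f v : ℝ)}) := by
    ext p
    simp only [lpRegion, Set.mem_ofPred_eq, Set.mem_inter_iff, Set.mem_iInter, and_assoc]
  rw [hset]
  refine ((((IsClosed.inter ?_ ?_).inter ?_).inter ?_).inter ?_).inter ?_
  · exact isClosed_biInter fun e _ =>
      (isClosed_le (by fun_prop) (by fun_prop)).inter (isClosed_le (by fun_prop) (by fun_prop))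
  · exact isClosed_iInter fun e => isClosed_iInter fun _ =>
      isClosed_eq (by fun_prop) (by fun_prop)
  · exact isClosed_biInter fun v _ => isClosed_le (by fun_prop) (by fun_prop)
  · exact isClosed_iInter fun e => isClosed_iInter fun _ =>
      isClosed_eq (by fun_prop) (by fun_prop)
  · exact isClosed_biInter fun v _ => isClosed_iInter fun _ =>
      isClosed_le (by fun_prop) (by fun_prop)
  · exact isClosed_biInter fun v _ => isClosed_iInter fun _ =>
      isClosed_le (by fun_prop) (by fun_prop)

/-- The objective function as a continuous linear functional. -/
noncomputable def lpFunctional (ε : ℝ) (H : Subproblem V) :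
    StrongDual ℝ ((Sym2 V → ℝ) × (V → ℝ)) :=
  LinearMap.toContinuousLinearMap
    { toFun := lpObjective ε H
      map_add' := fun p q => by
        simp only [lpObjective, Prod.fst_add, Prod.snd_add, Pi.add_apply, Finset.sum_add_distrib]
        ring
      map_smul' := fun a p => by
        simp only [lpObjective, Prod.smul_fst, Prod.smul_snd, Pi.smul_apply, smul_eq_mul,
          ← Finset.mul_sum, RingHom.id_apply]
        ring }

lemma zero_mem_lpRegion (H : Subproblem V) : (0 : (Sym2 V → ℝ) × (V → ℝ)) ∈ lpRegion H := by
  simp [lpRegion]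

/-- The linear program has an optimal corner although its region is unbounded: the `z v` cost, so
the part of the region with nonnegative objective is compact, and the optimal face lies in it. -/
lemma exists_isLPSolution {ε : ℝ} (hε : 0 < ε) (H : Subproblem V) :
    ∃ y z, IsLPSolution ε H y z := by
  set M : ℝ := 2 * H.edges.card with hM
  have hcont : Continuous (lpObjective ε H) := (lpFunctional ε H).continuous
  have hcomp : IsCompact (lpRegion H ∩ {p | 0 ≤ lpObjective ε H p}) := by
    have hbox : IsCompact ((Set.univ.pi fun _ : Sym2 V => Set.Icc (0 : ℝ) 1) ×ˢ
        (Set.univ.pi fun _ : V => Set.Icc (0 : ℝ) M)) :=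
      (isCompact_univ_pi fun _ => isCompact_Icc).prod (isCompact_univ_pi fun _ => isCompact_Icc)
    refine hbox.of_isClosed_subset
      ((isClosed_lpRegion H).inter (isClosed_le continuous_const hcont)) ?_
    rintro ⟨y, z⟩ ⟨hp, hobj⟩
    refine ⟨fun e _ => ?_, fun v _ => ⟨z_nonneg hp v, ?_⟩⟩
    · by_cases he : e ∈ H.edges
      · exact hp.1 e he
      · simp [show y e = 0 from hp.2.1 e he]
    · simp only [lpObjective, Set.mem_ofPred_eq] at hobj
      have hy : ∑ e ∈ H.edges, y e ≤ H.edges.card := by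
        simpa using Finset.sum_le_card_nsmul H.edges y 1 fun e he => (hp.1 e he).2
      have hz0 : 0 ≤ ∑ w ∈ H.verts, z w := Finset.sum_nonneg fun w _ => z_nonneg hp w
      have hzv : z v ≤ ∑ w ∈ H.verts, z w := by
        by_cases hv : v ∈ H.verts
        · exact Finset.single_le_sum (fun w _ => z_nonneg hp w) hv
        · rw [show z v = 0 from hp.2.2.2.1 v hv]; exact hz0
      show z v ≤ M
      nlinarith [mul_nonneg hε.le hz0]
  obtain ⟨p₀, ⟨hp₀, hp₀nonneg⟩, hmax⟩ := hcomp.exists_isMaxOn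
    ⟨0, zero_mem_lpRegion H, by simp [lpObjective]⟩ hcont.continuousOn
  have hopt : ∀ q ∈ lpRegion H, lpObjective ε H q ≤ lpObjective ε H p₀ := by
    intro q hq
    by_cases h : 0 ≤ lpObjective ε H q
    · exact hmax ⟨hq, h⟩
    · exact (not_le.1 h).le.trans hp₀nonneg
  set B := {p ∈ lpRegion H | ∀ q ∈ lpRegion H, lpFunctional ε H q ≤ lpFunctional ε H p} with hB
  have hexp : IsExposed ℝ (lpRegion H) B := fun _ => ⟨lpFunctional ε H, rfl⟩
  have hBcomp : IsCompact B := by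
    refine hcomp.of_isClosed_subset (hexp.isClosed (isClosed_lpRegion H)) ?_
    rintro p ⟨hp, hpmax⟩
    exact ⟨hp, hp₀nonneg.trans (hpmax p₀ hp₀)⟩
  obtain ⟨⟨y, z⟩, hyz⟩ := hBcomp.extremePoints_nonempty ⟨p₀, hp₀, hopt⟩
  exact ⟨y, z, hexp.isExtreme.extremePoints_subset_extremePoints hyz, hyz.1.2⟩

/-! ### The endpoint asked for by the rounding step -/

lemma IsLPSolution.z_eq_zero_of_mem_C {ε : ℝ} (hε : 0 < ε) {H : Subproblem V}
    {y : Sym2 V → ℝ} {z : V → ℝ} (h : IsLPSolution ε H y z) {v : V} (hv : v ∈ H.C) :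
    z v = 0 := by
  by_cases hvV : v ∈ H.verts
  swap
  · exact h.mem_lpRegion.2.2.2.1 v hvV
  have hp := h.mem_lpRegion
  obtain ⟨p, hpR, hpo⟩ := exists_mem_lpRegion ε H y (fun w => z w - if w = v then z v else 0)
    hp.1 (fun w _ => by
      split_ifs with hw
      · simp [hw]
      · simpa using z_nonneg hp w)
    (fun w hw hwC => by
      have : w ≠ v := fun hwv => hwC (hwv ▸ hv)
      simpa [this] using hp.2.2.2.2.1 w hw hwC)
    (fun w hw hwC => hp.2.2.2.2.2 w hw hwC)
  have := h.2 p hpR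
  rw [hpo, lpObjective] at this
  simp only [Finset.sum_sub_distrib, Finset.sum_ite_eq', if_pos hvV] at this
  have h0 := z_nonneg hp v
  nlinarith [mul_nonneg hε.le h0]

lemma f_pos_of_z_eq_zero {H : Subproblem V} {y : Sym2 V → ℝ} {z : V → ℝ}
    (h : (y, z) ∈ lpRegion H) {e : Sym2 V} (he : e ∈ H.edges) (hy : 0 < y e) {v : V} (hv : v ∈ e)
    (hz : z v = 0) : 0 < H.f v := by
  have h1 := sum_incident_le h (Subproblem.mem_verts.2 ⟨e, he, hv⟩)
  have h2 : y e ≤ ∑ e ∈ H.edges.filter (fun e => v ∈ e), y e :=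
    Finset.single_le_sum (fun e' he' => (h.1 e' (Finset.mem_filter.1 he').1).1)
      (Finset.mem_filter.2 ⟨he, hv⟩)
  have : (0 : ℝ) < H.f v := by linarith
  exact_mod_cast this

/-- If both `z u` and `z v` were positive, lowering `y s(u, v)`, `z u` and `z v` by a common
`δ > 0` would gain `2 * (1 + ε) * δ - 2 * δ > 0`. -/
lemma IsLPSolution.exists_endpoint {ε : ℝ} (hε : 0 < ε) {H : Subproblem V}
    {y : Sym2 V → ℝ} {z : V → ℝ} (h : IsLPSolution ε H y z) {u v : V} (huv : u ≠ v)
    (he : s(u, v) ∈ H.edges) (hy : 0 < y s(u, v)) :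
    (0 < H.f u ∧ z u = 0) ∨ (0 < H.f v ∧ z v = 0) := by
  have hp := h.mem_lpRegion
  by_contra hcon
  push Not at hcon
  have hzu : 0 < z u := lt_of_le_of_ne (z_nonneg hp u) fun h0 =>
    hcon.1 (f_pos_of_z_eq_zero hp he hy (Sym2.mem_mk_left u v) h0.symm) h0.symm
  have hzv : 0 < z v := lt_of_le_of_ne (z_nonneg hp v) fun h0 =>
    hcon.2 (f_pos_of_z_eq_zero hp he hy (Sym2.mem_mk_right u v) h0.symm) h0.symm
  obtain ⟨δ, hδ, hδy, hδu, hδv⟩ : ∃ δ > 0, δ ≤ y s(u, v) ∧ δ ≤ z u ∧ δ ≤ z v :=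
    ⟨min (y s(u, v)) (min (z u) (z v)), by positivity, min_le_left _ _,
      (min_le_right _ _).trans (min_le_left _ _), (min_le_right _ _).trans (min_le_right _ _)⟩
  obtain ⟨p, hpR, hpo⟩ := exists_mem_lpRegion ε H
    (fun e => y e - if e = s(u, v) then δ else 0)
    (fun w => z w - (if w = u then δ else 0) - (if w = v then δ else 0))
    (fun e he' => by
      have := hp.1 e he'
      dsimp only at this ⊢
      split_ifs with h1
      · subst h1; constructor <;> linarith
      · simpa using this)
    (fun w _ => by
      have := z_nonneg hp w
      split_ifs with h1 h2 h2
      · exact absurd (h1.symm.trans h2) huv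
      · subst h1; linarith
      · subst h2; linarith
      · linarith)
    (fun w hw hwC => by
      have := hp.2.2.2.2.1 w hw hwC
      simp only [Finset.sum_sub_distrib, Finset.sum_ite_eq', Finset.mem_filter, he, true_and,
        Sym2.mem_iff] at this ⊢
      by_cases h1 : w = u
      · subst h1; simp [huv]; linarith
      · by_cases h2 : w = v
        · subst h2; simp [h1]; linarith
        · simp [h1, h2]; linarith)
    (fun w hw hwC => by
      refine le_trans (Finset.sum_le_sum fun e _ => ?_) (hp.2.2.2.2.2 w hw hwC)
      split_ifs <;> dsimp only <;> linarith)
  have := h.2 p hpR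
  rw [hpo, lpObjective] at this
  simp only [Finset.sum_sub_distrib, Finset.sum_ite_eq', if_pos he,
    if_pos (Subproblem.mem_verts.2 ⟨_, he, Sym2.mem_mk_left u v⟩),
    if_pos (Subproblem.mem_verts.2 ⟨_, he, Sym2.mem_mk_right u v⟩)] at this
  nlinarith [mul_pos hε hδ]

/-! ### The edge asked for by the rounding step -/

lemma eventually_nonneg_add_mul {a : ℝ} (ha : 0 < a) (b : ℝ) :
    ∀ᶠ t : ℝ in nhds 0, 0 ≤ a + t * b := by
  have hc : Continuous fun t : ℝ => a + t * b := by fun_prop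
  exact ((hc.tendsto 0).eventually_const_lt (by simpa using ha)).mono fun t ht => ht.le

/-- The vertices of `H` at which `z` vanishes and the degree constraint is tight. -/
noncomputable def tightVerts (H : Subproblem V) (y : Sym2 V → ℝ) (z : V → ℝ) : Finset V :=
  H.verts.filter
    (fun v => z v = 0 ∧ ∑ e ∈ H.edges.filter (fun e => v ∈ e), y e = (H.f v : ℝ))

/-- If there were fewer tight vertices than edges, some nonzero `D` supported on the edges would
have degree sum `0` at every tight vertex. Moving `y` along `D`, and each positive `z v` along the
degree sum of `D` at `v`, stays in the region for small steps of both signs. -/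
lemma IsLPSolution.card_edges_le_card_tightVerts {ε : ℝ} (hε : 0 < ε) {H : Subproblem V}
    {y : Sym2 V → ℝ} {z : V → ℝ} (h : IsLPSolution ε H y z)
    (hpos : ∀ e ∈ H.edges, 0 < y e) (hlt : ∀ e ∈ H.edges, y e < 1) :
    H.edges.card ≤ (tightVerts H y z).card := by
  have hp := h.mem_lpRegion
  by_contra! hcard
  set W := tightVerts H y z with hW
  let L : (Sym2 V → ℝ) →ₗ[ℝ] (W → ℝ) × ((H.edgesᶜ : Finset (Sym2 V)) → ℝ) :=
    { toFun := fun d => (fun w => ∑ e ∈ H.edges.filter (fun e => (w : V) ∈ e), d e, fun e => d e)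
      map_add' := fun d d' => by
        ext <;> simp [Finset.sum_add_distrib]
      map_smul' := fun a d => by
        ext <;> simp [Finset.mul_sum] }
  have hker : LinearMap.ker L ≠ ⊥ := by
    apply LinearMap.ker_ne_bot_of_finrank_lt
    have := Finset.card_le_univ H.edges
    simp only [Module.finrank_prod, Module.finrank_fintype_fun_eq_card, Fintype.card_coe,
      Finset.card_compl]
    omega
  obtain ⟨D, hDker, hD0⟩ := (Submodule.ne_bot_iff _).1 hker
  have hDW : ∀ w ∈ W, ∑ e ∈ H.edges.filter (fun e => w ∈ e), D e = 0 := fun w hw =>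
    congr_fun (congr_arg Prod.fst (LinearMap.mem_ker.1 hDker)) ⟨w, hw⟩
  have hDE : ∀ e, e ∉ H.edges → D e = 0 := fun e he =>
    congr_fun (congr_arg Prod.snd (LinearMap.mem_ker.1 hDker)) ⟨e, Finset.mem_compl.2 he⟩
  set dz : V → ℝ := fun v =>
    if z v = 0 then 0 else ∑ e ∈ H.edges.filter (fun e => v ∈ e), D e with hdz
  have hmove : ∀ᶠ t : ℝ in nhds 0, (y + t • D, z + t • dz) ∈ lpRegion H := by
    have hE : ∀ᶠ t : ℝ in nhds 0, ∀ e, e ∈ H.edges → 0 ≤ y e + t * D e ∧ y e + t * D e ≤ 1 := by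
      refine Filter.eventually_all.2 fun e => ?_
      by_cases he : e ∈ H.edges
      · filter_upwards [eventually_nonneg_add_mul (hpos e he) (D e),
          eventually_nonneg_add_mul (sub_pos.2 (hlt e he)) (-D e)] with t h1 h2 _
        exact ⟨h1, by linarith⟩
      · exact Filter.Eventually.of_forall fun t h' => absurd h' he
    have hV : ∀ᶠ t : ℝ in nhds 0, ∀ v, v ∈ H.verts → 0 ≤ z v + t * dz v ∧
        ∑ e ∈ H.edges.filter (fun e => v ∈ e), (y e + t * D e) ≤ H.f v + (z v + t * dz v) := by
      refine Filter.eventually_all.2 fun v => ?_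
      by_cases hv : v ∈ H.verts
      swap
      · exact Filter.Eventually.of_forall fun t h' => absurd h' hv
      have hle := sum_incident_le hp hv
      simp only [Finset.sum_add_distrib, ← Finset.mul_sum]
      by_cases hz : z v = 0
      · have hdzv : dz v = 0 := if_pos hz
        rw [hz, add_zero] at hle
        simp only [hz, hdzv, mul_zero, add_zero, le_refl, true_and]
        rcases hle.eq_or_lt with htight | hslack
        · have := hDW v (Finset.mem_filter.2 ⟨hv, hz, htight⟩)
          exact Filter.Eventually.of_forall fun t _ => by rw [this]; linarith
        · filter_upwards [eventually_nonneg_add_mul (sub_pos.2 hslack)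
            (-∑ e ∈ H.edges.filter (fun e => v ∈ e), D e)] with t ht _
          linarith
      · have hdzv : dz v = ∑ e ∈ H.edges.filter (fun e => v ∈ e), D e := if_neg hz
        filter_upwards [eventually_nonneg_add_mul
          (lt_of_le_of_ne (z_nonneg hp v) (Ne.symm hz)) (dz v)] with t ht _
        exact ⟨ht, by rw [hdzv]; linarith⟩
    filter_upwards [hE, hV] with t htE htV
    refine ⟨htE, fun e he => ?_, fun v hv => (htV v hv).1, fun v hv => ?_,
      fun v hv _ => (htV v hv).2, fun v hv hC => ?_⟩
    · simp [hDE e he, show y e = 0 from hp.2.1 e he]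
    · have : z v = 0 := hp.2.2.2.1 v hv
      simp [hdz, this]
    · have hz := h.z_eq_zero_of_mem_C hε hC
      have := (htV v hv).2
      simpa [hdz, hz] using this
  obtain ⟨t, ⟨htp, htm⟩, ht0⟩ : ∃ t : ℝ, ((y + t • D, z + t • dz) ∈ lpRegion H ∧
      (y + (-t) • D, z + (-t) • dz) ∈ lpRegion H) ∧ 0 < t := by
    have hneg : Filter.Tendsto (fun t : ℝ => -t) (nhds 0) (nhds 0) := by
      simpa using (continuous_neg.tendsto (0 : ℝ))
    have hev := hmove.and (hneg.eventually hmove)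
    exact ((hev.filter_mono nhdsWithin_le_nhds).and
      (self_mem_nhdsWithin : Set.Ioi (0 : ℝ) ∈ nhdsWithin 0 (Set.Ioi 0))).exists
  have hseg : (y, z) ∈ openSegment ℝ (y + t • D, z + t • dz) (y + (-t) • D, z + (-t) • dz) := by
    refine ⟨1 / 2, 1 / 2, by norm_num, by norm_num, by norm_num, ?_⟩
    ext <;> simp <;> ring
  have heq := h.1.2 htp htm hseg
  apply hD0
  ext e
  have h1 : y e + t * D e = y e := congr_fun (congr_arg Prod.fst heq) e
  simpa [ht0.ne'] using h1

/-- If `0 < y e < 1 / 2` throughout, a tight vertex would have a positive integer degree sum, so at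
least three incident edges. Since there are at least as many tight vertices as edges, double
counting would give `3 * |E| ≤ 2 * |E|`. -/
lemma IsLPSolution.exists_half_le {ε : ℝ} (hε : 0 < ε) {H : Subproblem V}
    {y : Sym2 V → ℝ} {z : V → ℝ} (h : IsLPSolution ε H y z) (hE : H.edges ≠ ∅)
    (hne : ∀ e ∈ H.edges, y e ≠ 0) : ∃ e ∈ H.edges, 1 / 2 ≤ y e := by
  have hp := h.mem_lpRegion
  have hpos : ∀ e ∈ H.edges, 0 < y e := fun e he =>
    lt_of_le_of_ne (hp.1 e he).1 (hne e he).symm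
  by_contra! hhalf
  have hcard := h.card_edges_le_card_tightVerts hε hpos
    fun e he => (hhalf e he).trans (by norm_num)
  have hdeg : ∀ v ∈ tightVerts H y z, 3 ≤ (H.edges.filter (fun e => v ∈ e)).card := by
    intro v hv
    obtain ⟨hvV, hz, htight⟩ := Finset.mem_filter.1 hv
    obtain ⟨e, he, hve⟩ := Subproblem.mem_verts.1 hvV
    have hf : (1 : ℝ) ≤ H.f v := by
      exact_mod_cast f_pos_of_z_eq_zero hp he (hpos e he) hve hz
    have hlt : ∑ e ∈ H.edges.filter (fun e => v ∈ e), y e <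
        ∑ e ∈ H.edges.filter (fun e => v ∈ e), (1 / 2 : ℝ) :=
      Finset.sum_lt_sum_of_nonempty ⟨e, Finset.mem_filter.2 ⟨he, hve⟩⟩
        fun e' he' => hhalf e' (Finset.mem_filter.1 he').1
    rw [Finset.sum_const, nsmul_eq_mul] at hlt
    have : (2 : ℝ) < (H.edges.filter (fun e => v ∈ e)).card := by linarith
    exact_mod_cast this
  have h1 : (tightVerts H y z).card * 3 ≤
      ∑ v ∈ tightVerts H y z, (H.edges.filter (fun e => v ∈ e)).card := by
    simpa using Finset.card_nsmul_le_sum _ _ 3 hdeg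
  have h2 : ∑ e ∈ H.edges, ((tightVerts H y z).filter (fun v => v ∈ e)).card ≤
      H.edges.card * 2 := by
    simpa using Finset.sum_le_card_nsmul _ _ 2 fun e _ => card_filter_mem_le_two e _
  rw [sum_card_incident] at h1
  have := Finset.card_pos.2 (Finset.nonempty_iff_ne_empty.2 hE)
  omega

/-! ### The loss of the linear program in a call -/

/-- Scaling the part of `y` selected by `q` lowers its sum to `B`, at a cost of at most the
excess `δ`. -/
lemma exists_scaled {ι : Type*} (S : Finset ι) (q : ι → Prop) [DecidablePred q] (y : ι → ℝ)
    (hy : ∀ i ∈ S, 0 ≤ y i) {B δ : ℝ} (hB : 0 ≤ B) (hδ : 0 ≤ δ)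
    (hsum : ∑ i ∈ S.filter q, y i ≤ B + δ) :
    ∃ y' : ι → ℝ, (∀ i ∈ S, 0 ≤ y' i ∧ y' i ≤ y i) ∧ ∑ i ∈ S.filter q, y' i ≤ B ∧
      ∑ i ∈ S, y i ≤ ∑ i ∈ S, y' i + δ := by
  have hs0 : 0 ≤ ∑ i ∈ S.filter q, y i :=
    Finset.sum_nonneg fun i hi => hy i (Finset.mem_filter.1 hi).1
  set s := ∑ i ∈ S.filter q, y i with hs
  obtain ⟨t, ht0, ht1, htB, htδ⟩ : ∃ t : ℝ, 0 ≤ t ∧ t ≤ 1 ∧ t * s ≤ B ∧ s ≤ t * s + δ := by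
    by_cases h : s ≤ B
    · exact ⟨1, zero_le_one, le_rfl, by linarith, by linarith⟩
    · have hspos : 0 < s := hB.trans_lt (not_le.1 h)
      refine ⟨B / s, by positivity, (div_le_one hspos).2 (not_le.1 h).le, ?_, ?_⟩ <;>
        rw [div_mul_cancel₀ _ hspos.ne']
      exact hsum
  have hA : ∑ i ∈ S.filter q, (if q i then t * y i else y i) = t * s := by
    rw [hs, Finset.mul_sum]
    exact Finset.sum_congr rfl fun i hi => if_pos (Finset.mem_filter.1 hi).2
  have hA' : ∑ i ∈ S.filter (fun i => ¬ q i), (if q i then t * y i else y i) =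
      ∑ i ∈ S.filter (fun i => ¬ q i), y i :=
    Finset.sum_congr rfl fun i hi => if_neg (Finset.mem_filter.1 hi).2
  refine ⟨fun i => if q i then t * y i else y i, fun i hi => ?_, hA.trans_le htB, ?_⟩
  · have := hy i hi
    dsimp only
    split_ifs
    · exact ⟨by positivity, mul_le_of_le_one_left this ht1⟩
    · exact ⟨this, le_rfl⟩
  · rw [← Finset.sum_filter_add_sum_filter_not S q y,
      ← Finset.sum_filter_add_sum_filter_not S q (fun i => if q i then t * y i else y i), hA, hA']
    linarith

lemma le_lpObjective_discard {ε : ℝ} (hε : 0 < ε) {H : Subproblem V}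
    {y : Sym2 V → ℝ} {z : V → ℝ} (hp : (y, z) ∈ lpRegion H) {e : Sym2 V} (hy : y e = 0) :
    ∃ p ∈ lpRegion (H.discard e), lpObjective ε H (y, z) ≤ lpObjective ε (H.discard e) p := by
  have hsub : (H.discard e).edges ⊆ H.edges := Finset.erase_subset _ _
  have hV := Subproblem.verts_mono hsub
  have hle : ∀ v, ∑ e' ∈ (H.discard e).edges.filter (fun e => v ∈ e), y e' ≤
      ∑ e ∈ H.edges.filter (fun e => v ∈ e), y e := fun v =>
    Finset.sum_le_sum_of_subset_of_nonneg (Finset.filter_subset_filter _ hsub)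
      fun e' he' _ => (hp.1 e' (Finset.mem_filter.1 he').1).1
  obtain ⟨p, hpR, hpo⟩ := exists_mem_lpRegion ε (H.discard e) y z
    (fun e' he' => hp.1 e' (hsub he')) (fun v _ => z_nonneg hp v)
    (fun v hv hC => (hle v).trans (hp.2.2.2.2.1 v (hV hv) hC))
    (fun v hv hC => (hle v).trans (hp.2.2.2.2.2 v (hV hv) hC))
  refine ⟨p, hpR, ?_⟩
  have h1 : ∑ e' ∈ (H.discard e).edges, y e' = ∑ e ∈ H.edges, y e := Finset.sum_erase _ hy
  have h2 : ∑ v ∈ (H.discard e).verts, z v ≤ ∑ v ∈ H.verts, z v :=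
    Finset.sum_le_sum_of_subset_of_nonneg hV fun v _ _ => z_nonneg hp v
  rw [hpo, h1, lpObjective]
  have := mul_le_mul_of_nonneg_left h2 (by linarith : (0 : ℝ) ≤ 1 + ε)
  dsimp only
  linarith

/-- Rounding up an edge with `y s(u, v) ≥ 1 / 2` lowers the optimum of the linear program by at most
`3`. The edge itself accounts for `2 * y s(u, v)`. At each endpoint the bound drops by `1` and the
load by `y s(u, v)`; the difference `1 - y s(u, v)` is made up for at a price of at most `2` per
unit, by scaling down the other edges there, or at `u ∉ C` by raising `z u`. -/
lemma IsLPSolution.le_lpObjective_take {ε : ℝ} (hε : 0 < ε) (hε₁ : ε < 1) {H : Subproblem V}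
    {y : Sym2 V → ℝ} {z : V → ℝ} (h : IsLPSolution ε H y z) {u v : V} (huv : u ≠ v)
    (he : s(u, v) ∈ H.edges) (hy : 1 / 2 ≤ y s(u, v)) (hf : 0 < H.f v) (hz : z v = 0) :
    ∃ p ∈ lpRegion (H.take u v), lpObjective ε H (y, z) ≤ lpObjective ε (H.take u v) p + 3 := by
  have hp := h.mem_lpRegion
  set S := H.edges.erase s(u, v) with hS
  have hsub : S ⊆ H.edges := Finset.erase_subset _ _
  have hV : (H.take u v).verts ⊆ H.verts := Subproblem.verts_mono hsub
  have hy1 : y s(u, v) ≤ 1 := (hp.1 _ he).2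
  have hfu : ((H.take u v).f u) = H.f u - 1 := by simp [Subproblem.take]
  have hfv : ((H.take u v).f v) = H.f v - 1 := by simp [Subproblem.take, huv.symm]
  have hfw : ∀ w, w ≠ u → w ≠ v → (H.take u v).f w = H.f w := fun w h1 h2 => by
    simp [Subproblem.take, h1, h2]
  have hfuR : (H.f u : ℝ) - 1 ≤ ((H.f u - 1 : ℕ) : ℝ) := by
    have : H.f u ≤ (H.f u - 1 : ℕ) + 1 := by omega
    have : (H.f u : ℝ) ≤ ((H.f u - 1 : ℕ) : ℝ) + 1 := by exact_mod_cast this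
    linarith
  have hfvR : ((H.f v - 1 : ℕ) : ℝ) = (H.f v : ℝ) - 1 := by
    rw [Nat.cast_sub hf, Nat.cast_one]
  have hnn : ∀ e ∈ S, 0 ≤ y e := fun e he => (hp.1 e (hsub he)).1
  have hload : ∀ w ∈ s(u, v), ∑ e ∈ S.filter (fun e => w ∈ e), y e + y s(u, v) ≤
      H.f w + z w := fun w hw => by
    refine le_trans (le_of_eq ?_) (sum_incident_le hp (Subproblem.mem_verts.2 ⟨_, he, hw⟩))
    rw [hS, Finset.filter_erase, Finset.sum_erase_add _ _ (Finset.mem_filter.2 ⟨he, hw⟩)]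
  have hloadle : ∀ w, ∑ e ∈ S.filter (fun e => w ∈ e), y e ≤
      ∑ e ∈ H.edges.filter (fun e => w ∈ e), y e := fun w =>
    Finset.sum_le_sum_of_subset_of_nonneg (Finset.filter_subset_filter _ hsub)
      fun e' he' _ => (hp.1 e' (Finset.mem_filter.1 he').1).1
  have hlu := hload u (Sym2.mem_mk_left u v)
  have hlv := hload v (Sym2.mem_mk_right u v)
  obtain ⟨y₁, hy₁, hy₁v, hy₁S⟩ := exists_scaled S (fun e => v ∈ e) y hnn
    (B := ((H.f v - 1 : ℕ) : ℝ)) (δ := 1 - y s(u, v)) (Nat.cast_nonneg _) (by linarith)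
    (by rw [hfvR]; linarith)
  have hy₁u : ∑ e ∈ S.filter (fun e => u ∈ e), y₁ e ≤ ∑ e ∈ S.filter (fun e => u ∈ e), y e :=
    Finset.sum_le_sum fun e he => (hy₁ e (Finset.mem_filter.1 he).1).2
  obtain ⟨y₂, z₂, hy₂, hz₂, hz₂u, hstrict, hsoft, hcost⟩ : ∃ (y₂ : Sym2 V → ℝ) (z₂ : V → ℝ),
      (∀ e ∈ S, 0 ≤ y₂ e ∧ y₂ e ≤ y₁ e) ∧ (∀ w, 0 ≤ z₂ w) ∧ (∀ w, w ≠ u → z₂ w = z w) ∧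
      (u ∈ H.C → ∑ e ∈ S.filter (fun e => u ∈ e), y₂ e ≤ ((H.f u - 1 : ℕ) : ℝ)) ∧
      ∑ e ∈ S.filter (fun e => u ∈ e), y₂ e ≤ ((H.f u - 1 : ℕ) : ℝ) + z₂ u ∧
      2 * ∑ e ∈ S, y₁ e - (1 + ε) * ∑ w ∈ H.verts, z w ≤
        2 * ∑ e ∈ S, y₂ e - (1 + ε) * ∑ w ∈ H.verts, z₂ w + 2 * (1 - y s(u, v)) := by
    by_cases huC : u ∈ H.C
    · have hzu := h.z_eq_zero_of_mem_C hε huC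
      obtain ⟨y₂, hy₂, hy₂u, hy₂S⟩ := exists_scaled S (fun e => u ∈ e) y₁ (fun e he => (hy₁ e he).1)
        (B := ((H.f u - 1 : ℕ) : ℝ)) (δ := 1 - y s(u, v)) (Nat.cast_nonneg _) (by linarith)
        (by linarith)
      exact ⟨y₂, z, hy₂, z_nonneg hp, fun _ _ => rfl, fun _ => hy₂u, by rw [hzu]; linarith,
        by linarith⟩
    · refine ⟨y₁, fun w => z w + if w = u then 1 - y s(u, v) else 0,
        fun e he => ⟨(hy₁ e he).1, le_rfl⟩, fun w => ?_, fun w hw => by simp [hw],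
        fun h' => absurd h' huC, ?_, ?_⟩
      · have := z_nonneg hp w
        dsimp only
        split_ifs <;> linarith
      · simp only [if_true]
        linarith
      · rw [Finset.sum_add_distrib, Finset.sum_ite_eq',
          if_pos (Subproblem.mem_verts.2 ⟨_, he, Sym2.mem_mk_left u v⟩)]
        nlinarith
  have hy₂le : ∀ w, ∑ e ∈ S.filter (fun e => w ∈ e), y₂ e ≤
      ∑ e ∈ S.filter (fun e => w ∈ e), y₁ e := fun w =>
    Finset.sum_le_sum fun e he => (hy₂ e (Finset.mem_filter.1 he).1).2
  have hy₁le : ∀ w, ∑ e ∈ S.filter (fun e => w ∈ e), y₁ e ≤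
      ∑ e ∈ H.edges.filter (fun e => w ∈ e), y e := fun w =>
    (Finset.sum_le_sum fun e he => (hy₁ e (Finset.mem_filter.1 he).1).2).trans (hloadle w)
  obtain ⟨p, hpR, hpo⟩ := exists_mem_lpRegion ε (H.take u v) y₂ z₂
    (fun e he => ⟨(hy₂ e he).1,
      (hy₂ e he).2.trans ((hy₁ e he).2.trans (hp.1 e (hsub he)).2)⟩)
    (fun w _ => hz₂ w)
    (fun w hw hC => by
      have hwv : w ≠ v := fun h' => hC (h' ▸ Finset.mem_insert_self _ _)
      have hwC : w ∉ H.C := fun h' => hC (Finset.mem_insert_of_mem h')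
      by_cases hwu : w = u
      · rw [hwu, hfu]; exact hsoft
      · rw [hfw w hwu hwv, hz₂u w hwu]
        exact (hy₂le w).trans ((hy₁le w).trans (hp.2.2.2.2.1 w (hV hw) hwC)))
    (fun w hw hC => by
      by_cases hwv : w = v
      · rw [hwv, hfv]; exact (hy₂le v).trans hy₁v
      · have hwC : w ∈ H.C := (Finset.mem_insert.1 hC).resolve_left hwv
        by_cases hwu : w = u
        · rw [hwu, hfu]; exact hstrict (hwu ▸ hwC)
        · rw [hfw w hwu hwv]
          exact (hy₂le w).trans ((hy₁le w).trans (hp.2.2.2.2.2 w (hV hw) hwC)))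
  refine ⟨p, hpR, ?_⟩
  have hz' : ∑ w ∈ (H.take u v).verts, z₂ w ≤ ∑ w ∈ H.verts, z₂ w :=
    Finset.sum_le_sum_of_subset_of_nonneg hV fun w _ _ => hz₂ w
  have hz'' := mul_le_mul_of_nonneg_left hz' (by linarith : (0 : ℝ) ≤ 1 + ε)
  have hsplit : ∑ e ∈ S, y e + y s(u, v) = ∑ e ∈ H.edges, y e := Finset.sum_erase_add _ _ he
  have hedges : (H.take u v).edges = S := rfl
  rw [hpo, hedges, lpObjective]
  dsimp only
  linarith

/-! ### The output of the procedure -/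

/-- What a call on `H` returns, under its current bounds and relative to its linear program. The
vertices of `C` have to be respected in full, because earlier edges of the solution rely on
them. -/
structure IsGoodOutput (ε : ℝ) (H : Subproblem V) (E' : Finset (Sym2 V)) : Prop where
  subset : E' ⊆ H.edges
  strict : ∀ w ∈ H.C, edgeDegree E' w ≤ H.f w
  partly : ∀ e ∈ E', ∃ w ∈ e, edgeDegree E' w ≤ H.f w
  lp_le : ∀ p ∈ lpRegion H, lpObjective ε H p ≤ 3 * E'.card

lemma isGoodOutput_empty (ε : ℝ) {H : Subproblem V} (hE : H.edges = ∅) :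
    IsGoodOutput ε H ∅ where
  subset := Finset.empty_subset _
  strict := by simp [edgeDegree]
  partly := by simp
  lp_le := by simp [lpObjective, Subproblem.verts, hE]

lemma IsGoodOutput.of_discard {ε : ℝ} (hε : 0 < ε) {H : Subproblem V} {y : Sym2 V → ℝ}
    {z : V → ℝ} (hsol : IsLPSolution ε H y z) {e : Sym2 V} (hy : y e = 0)
    {E' : Finset (Sym2 V)} (h : IsGoodOutput ε (H.discard e) E') : IsGoodOutput ε H E' where
  subset := h.subset.trans (Finset.erase_subset _ _)
  strict := h.strict
  partly := h.partly
  lp_le p hp := by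
    obtain ⟨q, hq, hle⟩ := le_lpObjective_discard hε hsol.mem_lpRegion hy
    exact (hsol.2 p hp).trans (hle.trans (h.lp_le q hq))

lemma IsGoodOutput.of_take {ε : ℝ} (hε : 0 < ε) (hε₁ : ε < 1) {H : Subproblem V}
    {y : Sym2 V → ℝ} {z : V → ℝ} (hsol : IsLPSolution ε H y z) {u v : V} (huv : u ≠ v)
    (he : s(u, v) ∈ H.edges) (hy : 1 / 2 ≤ y s(u, v)) (hf : 0 < H.f v) (hz : z v = 0)
    {E' : Finset (Sym2 V)} (h : IsGoodOutput ε (H.take u v) E') :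
    IsGoodOutput ε H (insert s(u, v) E') := by
  have hnot : s(u, v) ∉ E' := fun hmem => Finset.notMem_erase _ _ (h.subset hmem)
  have hfu : ((H.take u v).f u) = H.f u - 1 := by simp [Subproblem.take]
  have hfv : ((H.take u v).f v) = H.f v - 1 := by simp [Subproblem.take, huv.symm]
  -- Truncation at `f u = 0` is the only way in which a bound can fail to carry over.
  have hlift : ∀ w, edgeDegree E' w ≤ (H.take u v).f w → (w = u → 0 < H.f u) →
      edgeDegree (insert s(u, v) E') w ≤ H.f w := by
    intro w hw hwu
    rw [edgeDegree_insert hnot]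
    by_cases h1 : w = u
    · subst h1
      have := hwu rfl
      rw [hfu] at hw
      simp only [Sym2.mem_mk_left, if_true]
      omega
    · by_cases h2 : w = v
      · subst h2
        rw [hfv] at hw
        simp only [Sym2.mem_mk_right, if_true]
        omega
      · simpa [Subproblem.take, h1, h2] using hw
  have hvgood : edgeDegree (insert s(u, v) E') v ≤ H.f v :=
    hlift v (h.strict v (Finset.mem_insert_self _ _)) fun h' => absurd h'.symm huv
  refine ⟨Finset.insert_subset he (h.subset.trans (Finset.erase_subset _ _)),
    fun w hw => ?_, fun e' he' => ?_, fun p hp => ?_⟩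
  · refine hlift w (h.strict w (Finset.mem_insert_of_mem hw)) fun hwu => ?_
    subst hwu
    exact f_pos_of_z_eq_zero hsol.mem_lpRegion he (by linarith) (Sym2.mem_mk_left w v)
      (hsol.z_eq_zero_of_mem_C hε hw)
  · rcases Finset.mem_insert.1 he' with rfl | he'
    · exact ⟨v, Sym2.mem_mk_right u v, hvgood⟩
    · obtain ⟨w, hwe, hw⟩ := h.partly e' he'
      refine ⟨w, hwe, hlift w hw fun hwu => ?_⟩
      have hpos := edgeDegree_pos he' hwe
      subst hwu
      omega
  · obtain ⟨q, hq, hle⟩ := hsol.le_lpObjective_take hε hε₁ huv he hy hf hz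
    have := h.lp_le q hq
    have := hsol.2 p hp
    rw [Finset.card_insert_of_notMem hnot]
    push_cast
    linarith

theorem SolveIP2.exists_isGoodOutput {ε : ℝ} (hε : 0 < ε) (hε₁ : ε < 1) {k : ℕ}
    {H : Subproblem V} {r : Option (Finset (Sym2 V))} (h : SolveIP2 ε k H r)
    (hloop : ∀ e ∈ H.edges, ¬ e.IsDiag) (hk : H.edges.card ≤ k) :
    ∃ E', r = some E' ∧ IsGoodOutput ε H E' := by
  induction h with
  | empty k H hE => exact ⟨∅, rfl, isGoodOutput_empty ε hE⟩
  | outOfCalls H hE => exact absurd (Finset.card_eq_zero.1 (Nat.le_zero.1 hk)) hE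
  | noSolution k H hE hno =>
    obtain ⟨y, z, hsol⟩ := exists_isLPSolution hε H
    exact absurd hsol (hno y z)
  | zero k H y z hsol e he hy r hr ih =>
    obtain ⟨E', rfl, hE'⟩ := ih (fun e' he' => hloop e' (Finset.mem_of_mem_erase he'))
      (by simpa [Subproblem.discard, Finset.card_erase_of_mem he] using hk)
    exact ⟨E', rfl, hE'.of_discard hε hsol hy⟩
  | noEdge k H hE y z hsol hpos hno =>
    obtain ⟨e, he, hy⟩ := hsol.exists_half_le hε hE hpos
    exact absurd hy (hno e he)
  | noEndpoint k H y z hsol hpos u v he hy hu hv =>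
    rcases hsol.exists_endpoint hε (hloop _ he) he (by linarith) with h | h
    · exact absurd h hu
    · exact absurd h hv
  | round k H y z hsol hpos u v he hy hf hz r hr ih =>
    obtain ⟨E', rfl, hE'⟩ := ih (fun e' he' => hloop e' (Finset.mem_of_mem_erase he'))
      (by simpa [Subproblem.take, Finset.card_erase_of_mem he] using hk)
    exact ⟨_, rfl, hE'.of_take hε hε₁ hsol (hloop _ he) he hy hf hz⟩

/-- Every call has an execution: the failing outcomes cover the cases in which it is stuck. -/
lemma exists_solveIP2 (ε : ℝ) (k : ℕ) (H : Subproblem V) : ∃ r, SolveIP2 ε k H r := by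
  induction k generalizing H with
  | zero =>
    by_cases hE : H.edges = ∅
    · exact ⟨_, .empty 0 H hE⟩
    · exact ⟨_, .outOfCalls H hE⟩
  | succ k ih =>
    by_cases hE : H.edges = ∅
    · exact ⟨_, .empty (k + 1) H hE⟩
    by_cases hsol : ∃ y z, IsLPSolution ε H y z
    swap
    · exact ⟨_, .noSolution k H hE fun y z h => hsol ⟨y, z, h⟩⟩
    obtain ⟨y, z, hsol⟩ := hsol
    by_cases hpos : ∀ e ∈ H.edges, y e ≠ 0
    swap
    · push Not at hpos
      obtain ⟨e, he, hy⟩ := hpos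
      obtain ⟨r, hr⟩ := ih (H.discard e)
      exact ⟨r, .zero k H y z hsol e he hy r hr⟩
    by_cases hhalf : ∀ e ∈ H.edges, ¬ 1 / 2 ≤ y e
    · exact ⟨_, .noEdge k H hE y z hsol hpos hhalf⟩
    push Not at hhalf
    obtain ⟨⟨u, v⟩, he, hy⟩ := hhalf
    by_cases hv : 0 < H.f v ∧ z v = 0
    · obtain ⟨r, hr⟩ := ih (H.take u v)
      exact ⟨_, .round k H y z hsol hpos u v he hy hv.1 hv.2 r hr⟩
    by_cases hu : 0 < H.f u ∧ z u = 0
    · obtain ⟨r, hr⟩ := ih (H.take v u)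
      have hswap : (Sym2.mk u v) = s(v, u) := Sym2.eq_swap
      exact ⟨_, .round k H y z hsol hpos v u (hswap ▸ he) (hswap ▸ hy) hu.1 hu.2 r hr⟩
    · exact ⟨_, .noEndpoint k H y z hsol hpos u v he hy hu hv⟩

/-! ### Comparison with feasible solutions -/

/-- Each edge of a feasible `F` has at most one endpoint that exceeds its bound, so the excess
degrees add up to at most `|F|`. -/
lemma IsFeasible.sum_excess_le {G : SimpleGraph V} {c : V → ℕ} {F : Finset (Sym2 V)}
    (hF : IsFeasible G c F) : ∑ v, (edgeDegree F v - c v) ≤ F.card := by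
  set bad := Finset.univ.filter (fun v => c v < edgeDegree F v) with hbad
  calc ∑ v, (edgeDegree F v - c v)
      = ∑ v ∈ bad, (edgeDegree F v - c v) := by
        refine (Finset.sum_subset (Finset.subset_univ _) fun v _ hv => ?_).symm
        simpa [hbad, Nat.sub_eq_zero_iff_le] using hv
    _ ≤ ∑ v ∈ bad, edgeDegree F v := Finset.sum_le_sum fun v _ => Nat.sub_le _ _
    _ = ∑ e ∈ F, (bad.filter (fun v => v ∈ e)).card := sum_card_incident bad F
    _ ≤ ∑ _e ∈ F, 1 := by
        refine Finset.sum_le_sum fun e he => ?_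
        induction e with
        | _ a b =>
          refine Finset.card_le_one.2 fun x hx w hw => ?_
          simp only [hbad, Finset.mem_filter, Finset.mem_univ, true_and, Sym2.mem_iff] at hx hw
          rcases hF.2 a b he with h | h <;> rcases hx with ⟨hx, rfl | rfl⟩ <;>
            rcases hw with ⟨hw, rfl | rfl⟩ <;> first | rfl | omega
    _ = F.card := by simp

/-- A feasible `F` is a point of the initial linear program: `y` is its indicator function and `z`
the excess degree. -/
lemma IsFeasible.exists_le_lpObjective {G : SimpleGraph V} [DecidableRel G.Adj] {c : V → ℕ}
    {F : Finset (Sym2 V)} (hF : IsFeasible G c F) {ε : ℝ} (hε : 0 < ε) :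
    ∃ p ∈ lpRegion (initial G c), (1 - ε) * F.card ≤ lpObjective ε (initial G c) p := by
  have hsub : F ⊆ (initial G c).edges := fun e he => SimpleGraph.mem_edgeFinset.2 (hF.1 e he)
  have hdeg : ∀ v, ∑ e ∈ (initial G c).edges.filter (fun e => v ∈ e),
      (if e ∈ F then (1 : ℝ) else 0) = edgeDegree F v := by
    intro v
    rw [Finset.sum_boole, edgeDegree, Finset.filter_comm, Finset.filter_mem_eq_inter,
      Finset.inter_eq_right.2 hsub]
  obtain ⟨p, hp, hpo⟩ := exists_mem_lpRegion ε (initial G c) (fun e => if e ∈ F then 1 else 0)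
    (fun v => ((edgeDegree F v - c v : ℕ) : ℝ))
    (fun e _ => by split_ifs <;> norm_num)
    (fun v _ => Nat.cast_nonneg _)
    (fun v _ _ => by
      rw [hdeg]
      have : edgeDegree F v ≤ c v + (edgeDegree F v - c v) := by omega
      exact_mod_cast this)
    (fun v _ hC => absurd hC (Finset.notMem_empty v))
  refine ⟨p, hp, ?_⟩
  have h1 : ∑ e ∈ (initial G c).edges, (if e ∈ F then (1 : ℝ) else 0) = F.card := by
    rw [Finset.sum_boole, Finset.filter_mem_eq_inter, Finset.inter_eq_right.2 hsub]
  have h2 : ∑ v ∈ (initial G c).verts, ((edgeDegree F v - c v : ℕ) : ℝ) ≤ F.card := by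
    refine le_trans (Finset.sum_le_sum_of_subset_of_nonneg (Finset.subset_univ _)
      fun v _ _ => Nat.cast_nonneg _) ?_
    exact_mod_cast hF.sum_excess_le
  rw [hpo, h1]
  nlinarith

lemma IsGoodOutput.isFeasible {ε : ℝ} {G : SimpleGraph V} [DecidableRel G.Adj] {c : V → ℕ}
    {E' : Finset (Sym2 V)} (h : IsGoodOutput ε (initial G c) E') : IsFeasible G c E' := by
  refine ⟨fun e he => SimpleGraph.mem_edgeFinset.1 (h.subset he), fun u v huv => ?_⟩
  obtain ⟨w, hw, hle⟩ := h.partly _ huv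
  rcases Sym2.mem_iff.1 hw with rfl | rfl
  · exact Or.inl hle
  · exact Or.inr hle

end PDBEP

theorem theorem3 {V : Type*} [Fintype V] [DecidableEq V] (G : SimpleGraph V) [DecidableRel G.Adj]
    (c : V → ℕ) (ε : ℝ) (hε₀ : 0 < ε) (hε₁ : ε < 1) :
    (∃ r, PDBEP.SolveIP2 ε G.edgeFinset.card (PDBEP.initial G c) r) ∧
    ∀ r, PDBEP.SolveIP2 ε G.edgeFinset.card (PDBEP.initial G c) r →
      ∃ E' : Finset (Sym2 V), r = some E' ∧
        PDBEP.IsFeasible G c E' ∧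
        ∀ F : Finset (Sym2 V), PDBEP.IsFeasible G c F →
          (F.card : ℝ) ≤ 3 / (1 - ε) ^ 2 * (E'.card : ℝ) := by
  refine ⟨PDBEP.exists_solveIP2 _ _ _, fun r hr => ?_⟩
  obtain ⟨E', rfl, hE'⟩ := hr.exists_isGoodOutput hε₀ hε₁
    (fun e he => G.not_isDiag_of_mem_edgeSet (SimpleGraph.mem_edgeFinset.1 he)) le_rfl
  refine ⟨E', rfl, hE'.isFeasible, fun F hF => ?_⟩
  obtain ⟨p, hp, hle⟩ := hF.exists_le_lpObjective hε₀
  have h1 : (1 - ε) * F.card ≤ 3 * E'.card := hle.trans (hE'.lp_le p hp)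
  have hpos : 0 < 1 - ε := by linarith
  -- The argument loses only one factor `1 - ε`; the second one is slack.
  have h2 : (1 - ε) * ((1 - ε) * F.card) ≤ 1 * ((1 - ε) * F.card) :=
    mul_le_mul_of_nonneg_right (by linarith) (by positivity)
  rw [div_mul_eq_mul_div, le_div_iff₀ (by positivity)]
  linarith
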